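/- Let $m,n\ge 0$ be integers and call a complex random vector in $\mathbb{C}^k$ any random vector whose law is absolutely continuous with respect to Lebesgue measure $\lambda_{2k}$ on $\mathbb{C}^k\cong\mathbb{R}^{2k}$. Such a vector $\mathbf{x}$ is circular if $e^{j2\pi\theta}\mathbf{x}$ has the same law as $\mathbf{x}$ for all $\theta\in[0,1)$. Its circular analog is $\mathbf{x}_{(a)}=e^{j2\pi\psi}\mathbf{x}$, where $\psi$ is uniformly distributed on $[0,1)$ and independent of $\mathbf{x}$ (in the channel below, of $\mathbf{x}$ and the noise). Consider the channel $\mathbf{y}=\mathbf{H}\mathbf{x}+\mathbf{z}$ with a deterministic matrix $\mathbf{H}\in\mathbb{C}^{n\times m}$, a circular complex random noise vector $\mathbf{z}$ in $\mathbb{C}^n$, an input $\mathbf{x}$ in $\mathbb{C}^m$ that is a complex random vector independent of $\mathbf{z}$, and a set $\mathcal{I}$ of admissible input laws (all absolutely continuous with respect to $\lambda_{2m}$) that is closed under forming the circular analog. Write $\mathbf{x}\in\mathcal{I}$ if the law of $\mathbf{x}$ is in $\mathcal{I}$. Let $$C=\sup_{\mathbf{x}\in\mathcal{I}} I(\mathbf{x};\mathbf{H}\mathbf{x}+\mathbf{z})\in[0,\infty],$$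 where the mutual information $I(\mathbf{x};\mathbf{y})\in[0,\infty]$ is the Kullback--Leibler divergence of the joint law of $(\mathbf{x},\mathbf{y})$ from the product of the laws of $\mathbf{x}$ and $\mathbf{y}$, i.e. $\int f_{\mathbf{x},\mathbf{y}}\log\frac{f_{\mathbf{x},\mathbf{y}}}{f_{\mathbf{x}}f_{\mathbf{y}}}$ in terms of pdfs. An input $\mathbf{x}\in\mathcal{I}$ is capacity-achieving if $I(\mathbf{x};\mathbf{H}\mathbf{x}+\mathbf{z})=C$. Then the circular analog of every capacity-achieving input is circular and is itself a capacity-achieving input (in particular it lies in $\mathcal{I}$). Consequently, if a capacity-achieving input exists, then there exists a circular capacity-achieving input. -/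

import Mathlib

open MeasureTheory InformationTheory
open scoped ENNReal

noncomputable section

/-- Laws of complex random vectors: Borel probability measures on `ℂⁿ ≅ ℝ²ⁿ` that have a pdf,
i.e. are absolutely continuous with respect to `2n`-dimensional Lebesgue measure. -/
def IsComplexVectorLaw {n : ℕ} (μ : Measure (Fin n → ℂ)) : Prop :=
  IsProbabilityMeasure μ ∧ μ ≪ volume

/-- Multiplication of a vector by the phase factor `e^{j 2 π θ}`. -/
def phaseRotate {n : ℕ} (θ : ℝ) (x : Fin n → ℂ) : Fin n → ℂ :=
  Complex.exp (2 * Real.pi * θ * Complex.I) • x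

/-- `x ∼ μ` is circular: `e^{j 2 π θ} x` has the same law as `x`, for all `θ ∈ [0, 1)`. -/
def IsCircular {n : ℕ} (μ : Measure (Fin n → ℂ)) : Prop :=
  ∀ θ ∈ Set.Ico (0 : ℝ) 1, μ.map (phaseRotate θ) = μ

/-- The law of the circular analog `e^{j 2 π ψ} x` of `x ∼ μ`, where `ψ` is uniformly distributed
on `[0, 1)` and independent of `x`. -/
def circularAnalog {n : ℕ} (μ : Measure (Fin n → ℂ)) : Measure (Fin n → ℂ) :=
  ((volume.restrict (Set.Ico (0 : ℝ) 1)).prod μ).map (fun p => phaseRotate p.1 p.2)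

/-- The mutual information (in nats, with values in `[0, ∞]`) of a pair with joint law `ρ`: the
Kullback-Leibler divergence of the joint law from the product of its marginals. -/
def mutualInfo {α β : Type*} [MeasurableSpace α] [MeasurableSpace β] (ρ : Measure (α × β)) :
    ℝ≥0∞ :=
  klDiv ρ (ρ.fst.prod ρ.snd)

/-- The joint law of input and output `(x, H x + z)` of the channel with matrix `H`, for an input
`x ∼ μ` and a noise vector `z ∼ ν` independent of it. -/
def channelLaw {m n : ℕ} (H : Matrix (Fin n) (Fin m) ℂ) (ν : Measure (Fin n → ℂ))
    (μ : Measure (Fin m → ℂ)) : Measure ((Fin m → ℂ) × (Fin n → ℂ)) :=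
  (μ.prod ν).map (fun p => (p.1, H.mulVec p.1 + p.2))

/-- The capacity: the supremum of `I(x; H x + z)` over the admissible input laws. -/
def capacity {m n : ℕ} (H : Matrix (Fin n) (Fin m) ℂ) (ν : Measure (Fin n → ℂ))
    (𝓘 : Set (Measure (Fin m → ℂ))) : ℝ≥0∞ :=
  ⨆ μ ∈ 𝓘, mutualInfo (channelLaw H ν μ)

/-- `x ∼ μ` is an admissible input that attains the capacity. -/
def IsCapacityAchieving {m n : ℕ} (H : Matrix (Fin n) (Fin m) ℂ) (ν : Measure (Fin n → ℂ))
    (𝓘 : Set (Measure (Fin m → ℂ))) (μ : Measure (Fin m → ℂ)) : Prop :=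
  μ ∈ 𝓘 ∧ mutualInfo (channelLaw H ν μ) = capacity H ν 𝓘

/-- A set of input laws that is closed under forming the circular analog. -/
def CircularClosed {m : ℕ} (𝓘 : Set (Measure (Fin m → ℂ))) : Prop :=
  ∀ μ ∈ 𝓘, circularAnalog μ ∈ 𝓘

end

open ProbabilityTheory

/-! Let `q` be the output law produced by the circular analog of `x`; it is circular. Replacing the
true output law by `q` in the divergence can only increase it, so `I(x; y) ≤ D(P_xy ‖ P_x × q)`
(`mutualInfo_le_klDiv_fst_prod`). One Markov kernel, which resamples the phase given the rotated
input and derotates input and output, carries the joint law of the rotated pair to `P_xy`, and also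
(law of the circular analog) `× q` to `P_x × q`, because the channel and the constant kernel `q` are
both rotation-equivariant (`derotationKernel_comp_compProd`). Data processing then bounds the right
side by the mutual information of the circular analog, which is admissible and so attains the
supremum too. -/

@[fun_prop]
lemma measurable_phaseRotate_apply {α : Type*} [MeasurableSpace α] {n : ℕ} {f : α → ℝ}
    {g : α → Fin n → ℂ} (hf : Measurable f) (hg : Measurable g) :
    Measurable (fun a => phaseRotate (f a) (g a)) := by
  unfold phaseRotate
  fun_prop

lemma measurable_phaseRotate {n : ℕ} :
    Measurable (fun p : ℝ × (Fin n → ℂ) => phaseRotate p.1 p.2) := by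
  fun_prop

lemma phaseRotate_add {n : ℕ} (s t : ℝ) (x : Fin n → ℂ) :
    phaseRotate (s + t) x = phaseRotate s (phaseRotate t x) := by
  simp only [phaseRotate, smul_smul, ← Complex.exp_add]
  congr 2
  push_cast
  ring

lemma phaseRotate_zero {n : ℕ} (x : Fin n → ℂ) : phaseRotate 0 x = x := by
  simp [phaseRotate]

lemma phaseRotate_neg_phaseRotate {n : ℕ} (t : ℝ) (x : Fin n → ℂ) :
    phaseRotate (-t) (phaseRotate t x) = x := by
  rw [← phaseRotate_add, neg_add_cancel, phaseRotate_zero]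

lemma phaseRotate_intCast {n : ℕ} (k : ℤ) (x : Fin n → ℂ) : phaseRotate k x = x := by
  have : Complex.exp (2 * Real.pi * ((k : ℝ) : ℂ) * Complex.I) = 1 :=
    Complex.exp_eq_one_iff.2 ⟨k, by push_cast; ring⟩
  rw [phaseRotate, this, one_smul]

lemma mulVec_phaseRotate_add {m n : ℕ} (H : Matrix (Fin n) (Fin m) ℂ) (t : ℝ)
    (x : Fin m → ℂ) (z : Fin n → ℂ) :
    H.mulVec (phaseRotate t x) + phaseRotate t z = phaseRotate t (H.mulVec x + z) := by
  simp only [phaseRotate, Matrix.mulVec_smul, smul_add]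

lemma measurable_mulVec {m n : ℕ} (H : Matrix (Fin n) (Fin m) ℂ) : Measurable H.mulVec := by
  have : Continuous H.mulVec := by fun_prop
  exact this.measurable

/-- All half-open unit intervals are fundamental domains for `ℤ` acting on `ℝ`. -/
lemma setLIntegral_Ico_comp_add_of_periodic {f : ℝ → ℝ≥0∞}
    (hf : ∀ (k : ℤ) (t : ℝ), f (k + t) = f t) (s : ℝ) :
    ∫⁻ t in Set.Ico (0 : ℝ) 1, f (s + t) = ∫⁻ t in Set.Ico (0 : ℝ) 1, f t := by
  have h1 : ∫⁻ t in Set.Ioc (0 : ℝ) (0 + 1), f (s + t) = ∫⁻ t in Set.Ioc s (s + 1), f t := by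
    have h := (measurePreserving_add_left volume s).setLIntegral_comp_preimage_emb
      (measurableEmbedding_addLeft s) f (Set.Ioc s (s + 1))
    rw [← h]
    simp
  rw [restrict_Ico_eq_restrict_Ioc, ← zero_add (1 : ℝ), h1]
  rw [zero_add]
  have h2 := (isAddFundamentalDomain_Ioc (zero_lt_one' ℝ) s).setLIntegral_eq
    (isAddFundamentalDomain_Ioc (zero_lt_one' ℝ) 0) f ?_
  · simpa using h2
  · rintro ⟨g, hg⟩ t
    obtain ⟨k, rfl⟩ := AddSubgroup.mem_zmultiples_iff.1 hg
    simpa [AddSubgroup.vadd_def] using hf k t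

lemma isProbabilityMeasure_restrict_Ico :
    IsProbabilityMeasure ((volume : Measure ℝ).restrict (Set.Ico (0 : ℝ) 1)) :=
  ⟨by simp⟩

lemma isProbabilityMeasure_circularAnalog {n : ℕ} (μ : Measure (Fin n → ℂ))
    [IsProbabilityMeasure μ] : IsProbabilityMeasure (circularAnalog μ) := by
  have := isProbabilityMeasure_restrict_Ico
  exact Measure.isProbabilityMeasure_map measurable_phaseRotate.aemeasurable

lemma lintegral_circularAnalog {n : ℕ} (μ : Measure (Fin n → ℂ)) [SFinite μ]
    {g : (Fin n → ℂ) → ℝ≥0∞} (hg : Measurable g) :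
    ∫⁻ x, g x ∂(circularAnalog μ) =
      ∫⁻ x, (∫⁻ t in Set.Ico (0 : ℝ) 1, g (phaseRotate t x)) ∂μ := by
  rw [circularAnalog, lintegral_map hg measurable_phaseRotate, lintegral_prod_symm']
  exact hg.comp measurable_phaseRotate

theorem isCircular_circularAnalog {n : ℕ} (μ : Measure (Fin n → ℂ)) [SFinite μ] :
    IsCircular (circularAnalog μ) := by
  intro s _
  refine Measure.ext_of_lintegral _ fun g hg => ?_
  rw [lintegral_map hg (by fun_prop), lintegral_circularAnalog μ hg,
    lintegral_circularAnalog μ (by fun_prop)]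
  refine lintegral_congr fun x => ?_
  simp only [← phaseRotate_add]
  refine setLIntegral_Ico_comp_add_of_periodic (f := fun t => g (phaseRotate t x)) ?_ s
  intro k t
  simp only [phaseRotate_add, phaseRotate_intCast]

/-- The channel `x ↦ law of H x + z`, `z ∼ ν`, as a Markov kernel. -/
noncomputable def channelKernel {m n : ℕ} (H : Matrix (Fin n) (Fin m) ℂ)
    (ν : Measure (Fin n → ℂ)) : Kernel (Fin m → ℂ) (Fin n → ℂ) :=
  (Kernel.id ×ₖ Kernel.const _ ν).map (fun p => H.mulVec p.1 + p.2)

lemma channelKernel_apply {m n : ℕ} (H : Matrix (Fin n) (Fin m) ℂ)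
    (ν : Measure (Fin n → ℂ)) [SFinite ν] (x : Fin m → ℂ) :
    channelKernel H ν x = ν.map (fun z => H.mulVec x + z) := by
  have hH := measurable_mulVec H
  rw [channelKernel, Kernel.map_apply _ (by fun_prop), Kernel.prod_apply, Kernel.id_apply,
    Kernel.const_apply, Measure.dirac_prod, Measure.map_map (by fun_prop) (by fun_prop)]
  rfl

instance isMarkovKernel_channelKernel {m n : ℕ} (H : Matrix (Fin n) (Fin m) ℂ)
    (ν : Measure (Fin n → ℂ)) [IsProbabilityMeasure ν] : IsMarkovKernel (channelKernel H ν) := by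
  have hH := measurable_mulVec H
  exact Kernel.IsMarkovKernel.map _ (by fun_prop)

lemma channelLaw_eq_compProd {m n : ℕ} (H : Matrix (Fin n) (Fin m) ℂ)
    (ν : Measure (Fin n → ℂ)) [IsProbabilityMeasure ν] (μ : Measure (Fin m → ℂ)) [SFinite μ] :
    channelLaw H ν μ = μ ⊗ₘ channelKernel H ν := by
  have hH := measurable_mulVec H
  refine Measure.ext_of_lintegral _ fun g hg => ?_
  rw [channelLaw, lintegral_map hg (by fun_prop), lintegral_prod _ (by fun_prop),
    Measure.lintegral_compProd hg]
  refine lintegral_congr fun x => ?_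
  rw [channelKernel_apply, lintegral_map (by fun_prop) (by fun_prop)]

/-- `H` commutes with scalars, and the rotated noise has the law of the noise. -/
lemma map_phaseRotate_channelKernel {m n : ℕ} (H : Matrix (Fin n) (Fin m) ℂ)
    (ν : Measure (Fin n → ℂ)) [SFinite ν] (hν : IsCircular ν) {t : ℝ}
    (ht : t ∈ Set.Ico (0 : ℝ) 1) (x : Fin m → ℂ) :
    (channelKernel H ν x).map (phaseRotate t) = channelKernel H ν (phaseRotate t x) := by
  rw [channelKernel_apply, channelKernel_apply, Measure.map_map (by fun_prop) (by fun_prop)]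
  conv_rhs => rw [← hν t ht, Measure.map_map (by fun_prop) (by fun_prop)]
  congr 1
  ext1 z
  simp only [Function.comp_apply, mulVec_phaseRotate_add]

/-- Makes the constant kernel at the output law rotation-equivariant. -/
lemma isCircular_snd_channelLaw {m n : ℕ} (H : Matrix (Fin n) (Fin m) ℂ)
    (ν : Measure (Fin n → ℂ)) [SFinite ν] (hν : IsCircular ν)
    (μ : Measure (Fin m → ℂ)) [SFinite μ] (hμ : IsCircular μ) :
    IsCircular (channelLaw H ν μ).snd := by
  have hH := measurable_mulVec H
  intro t ht
  have hrot : (μ.prod ν).map (Prod.map (phaseRotate t) (phaseRotate t)) = μ.prod ν := by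
    rw [← Measure.map_prod_map _ _ (by fun_prop) (by fun_prop), hμ t ht, hν t ht]
  have hsnd : (channelLaw H ν μ).snd = (μ.prod ν).map (fun p => H.mulVec p.1 + p.2) := by
    rw [Measure.snd, channelLaw, Measure.map_map (by fun_prop) (by fun_prop)]
    rfl
  rw [hsnd, Measure.map_map (by fun_prop) (by fun_prop)]
  conv_rhs => rw [← hrot, Measure.map_map (by fun_prop) (by fun_prop)]
  congr 1
  ext1 p
  simp only [Function.comp_apply, Prod.map, mulVec_phaseRotate_add]

/-- The joint law of the circular analog `e^{j 2 π ψ} x` and the phase `ψ`. -/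
noncomputable def rotatedPhaseLaw {m : ℕ} (μ : Measure (Fin m → ℂ)) :
    Measure ((Fin m → ℂ) × ℝ) :=
  ((volume.restrict (Set.Ico (0 : ℝ) 1)).prod μ).map (fun p => (phaseRotate p.1 p.2, p.1))

instance isProbabilityMeasure_rotatedPhaseLaw {m : ℕ} (μ : Measure (Fin m → ℂ))
    [IsProbabilityMeasure μ] : IsProbabilityMeasure (rotatedPhaseLaw μ) := by
  have := isProbabilityMeasure_restrict_Ico
  exact Measure.isProbabilityMeasure_map (by fun_prop)

lemma fst_rotatedPhaseLaw {m : ℕ} (μ : Measure (Fin m → ℂ)) :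
    (rotatedPhaseLaw μ).fst = circularAnalog μ := by
  rw [rotatedPhaseLaw, Measure.fst, Measure.map_map (by fun_prop) (by fun_prop)]
  rfl

/-- The kernel that resamples the phase `ψ` given the circular analog `e^{j 2 π ψ} x` and undoes
the rotation by `ψ` on input and output simultaneously. -/
noncomputable def derotationKernel {m : ℕ} (n : ℕ) (μ : Measure (Fin m → ℂ))
    [IsProbabilityMeasure μ] :
    Kernel ((Fin m → ℂ) × (Fin n → ℂ)) ((Fin m → ℂ) × (Fin n → ℂ)) :=
  (Kernel.id ×ₖ (rotatedPhaseLaw μ).condKernel.comap Prod.fst measurable_fst).map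
    (fun q => (phaseRotate (-q.2) q.1.1, phaseRotate (-q.2) q.1.2))

instance isMarkovKernel_derotationKernel {m n : ℕ} (μ : Measure (Fin m → ℂ))
    [IsProbabilityMeasure μ] : IsMarkovKernel (derotationKernel n μ) :=
  Kernel.IsMarkovKernel.map _ (by fun_prop)

lemma lintegral_derotationKernel {m n : ℕ} (μ : Measure (Fin m → ℂ)) [IsProbabilityMeasure μ]
    {g : (Fin m → ℂ) × (Fin n → ℂ) → ℝ≥0∞} (hg : Measurable g)
    (p : (Fin m → ℂ) × (Fin n → ℂ)) :
    ∫⁻ q, g q ∂(derotationKernel n μ p) =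
      ∫⁻ t, g (phaseRotate (-t) p.1, phaseRotate (-t) p.2)
        ∂((rotatedPhaseLaw μ).condKernel p.1) := by
  rw [derotationKernel, Kernel.map_apply _ (by fun_prop), lintegral_map hg (by fun_prop),
    Kernel.prod_apply, Kernel.id_apply, Measure.dirac_prod, Kernel.comap_apply,
    lintegral_map (by fun_prop) (by fun_prop)]

/-- Derotation carries the law of `(e^{j 2 π ψ} x, y)` back to that of `(x, y)`, for `y` generated
by a rotation-equivariant kernel. -/
theorem derotationKernel_comp_compProd {m n : ℕ} (μ : Measure (Fin m → ℂ))
    [IsProbabilityMeasure μ] (κ : Kernel (Fin m → ℂ) (Fin n → ℂ)) [IsMarkovKernel κ]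
    (hκ : ∀ t ∈ Set.Ico (0 : ℝ) 1, ∀ x, (κ x).map (phaseRotate t) = κ (phaseRotate t x)) :
    (derotationKernel n μ) ∘ₘ (circularAnalog μ ⊗ₘ κ) = μ ⊗ₘ κ := by
  have := isProbabilityMeasure_circularAnalog μ
  have := isProbabilityMeasure_restrict_Ico
  refine Measure.ext_of_lintegral _ fun g hg => ?_
  have hF : Measurable (fun q : ((Fin m → ℂ) × ℝ) =>
      ∫⁻ y, g (phaseRotate (-q.2) q.1, phaseRotate (-q.2) y) ∂(κ q.1)) :=
    Measurable.lintegral_kernel_prod_right' (κ := κ.comap Prod.fst measurable_fst)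
      (f := fun r : ((Fin m → ℂ) × ℝ) × (Fin n → ℂ) =>
        g (phaseRotate (-r.1.2) r.1.1, phaseRotate (-r.1.2) r.2)) (by fun_prop)
  calc ∫⁻ q, g q ∂((derotationKernel n μ) ∘ₘ (circularAnalog μ ⊗ₘ κ))
      = ∫⁻ x, ∫⁻ y, ∫⁻ t, g (phaseRotate (-t) x, phaseRotate (-t) y)
          ∂((rotatedPhaseLaw μ).condKernel x) ∂(κ x) ∂(circularAnalog μ) := by
        rw [Measure.lintegral_bind (derotationKernel n μ).aemeasurable hg.aemeasurable,
          Measure.lintegral_compProd hg.lintegral_kernel]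
        simp only [lintegral_derotationKernel μ hg]
    _ = ∫⁻ x, ∫⁻ t, ∫⁻ y, g (phaseRotate (-t) x, phaseRotate (-t) y)
          ∂(κ x) ∂((rotatedPhaseLaw μ).condKernel x) ∂(circularAnalog μ) := by
        -- Given the rotated input, output and resampled phase are independent, so Tonelli applies.
        refine lintegral_congr fun x => ?_
        rw [lintegral_lintegral_swap]
        exact Measurable.aemeasurable (by unfold Function.uncurry; fun_prop)
    _ = ∫⁻ q, ∫⁻ y, g (phaseRotate (-q.2) q.1, phaseRotate (-q.2) y) ∂(κ q.1)
          ∂(rotatedPhaseLaw μ) := by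
        conv_rhs => rw [← (rotatedPhaseLaw μ).disintegrate (rotatedPhaseLaw μ).condKernel,
          fst_rotatedPhaseLaw, Measure.lintegral_compProd hF]
    _ = ∫⁻ t in Set.Ico (0 : ℝ) 1, ∫⁻ x, ∫⁻ y,
          g (phaseRotate (-t) (phaseRotate t x), phaseRotate (-t) y)
          ∂(κ (phaseRotate t x)) ∂μ := by
        rw [rotatedPhaseLaw, lintegral_map hF (by fun_prop), lintegral_prod]
        exact (hF.comp (f := fun p : ℝ × (Fin m → ℂ) => (phaseRotate p.1 p.2, p.1))
          (by fun_prop)).aemeasurable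
    _ = ∫⁻ t in Set.Ico (0 : ℝ) 1, ∫⁻ x, ∫⁻ y, g (x, y) ∂(κ x) ∂μ := by
        refine setLIntegral_congr_fun measurableSet_Ico fun t ht => lintegral_congr fun x => ?_
        -- By equivariance `y` is itself a rotation by `t`, which derotation cancels; the integrand
        -- no longer depends on `t`.
        rw [← hκ t ht, lintegral_map (by fun_prop) (by fun_prop)]
        simp only [phaseRotate_neg_phaseRotate]
    _ = ∫⁻ q, g q ∂(μ ⊗ₘ κ) := by
        rw [Measure.lintegral_compProd hg, lintegral_const, measure_univ, mul_one]

/-- Data processing in both directions, as the swap is an involution. -/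
lemma klDiv_map_swap {α β : Type*} [MeasurableSpace α] [MeasurableSpace β]
    (ρ τ : Measure (α × β)) [IsFiniteMeasure ρ] [IsFiniteMeasure τ] :
    klDiv (ρ.map Prod.swap) (τ.map Prod.swap) = klDiv ρ τ := by
  refine le_antisymm (klDiv_map_le ρ τ measurable_swap) ?_
  have h := klDiv_map_le (ρ.map Prod.swap) (τ.map Prod.swap) measurable_swap
  simpa [Measure.map_map measurable_swap measurable_swap] using h

/-- The output marginal minimizes the divergence of the joint law from product laws. -/
theorem mutualInfo_le_klDiv_fst_prod {α β : Type*} [MeasurableSpace α] [StandardBorelSpace α]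
    [Nonempty α] [MeasurableSpace β] (ρ : Measure (α × β)) [IsProbabilityMeasure ρ]
    (q : Measure β) [IsProbabilityMeasure q] :
    mutualInfo ρ ≤ klDiv ρ (ρ.fst.prod q) := by
  -- The swap puts the output first, so that the chain rule splits off `D(ρ.snd ‖ r)`; the remaining
  -- term does not depend on `r`.
  have key : ∀ r : Measure β, IsProbabilityMeasure r → klDiv ρ (ρ.fst.prod r) =
      klDiv ((ρ.map Prod.swap).fst ⊗ₘ (ρ.map Prod.swap).condKernel)
        (r ⊗ₘ Kernel.const β ρ.fst) := by
    intro r _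
    rw [← klDiv_map_swap, Measure.prod_swap, Measure.compProd_const, Measure.disintegrate]
  rw [mutualInfo, key q inferInstance, key ρ.snd inferInstance, klDiv_compProd_eq_add _ q,
    Measure.fst_map_swap]
  rw [klDiv_compProd_eq_add, klDiv_self, zero_add]
  exact le_add_self

/-- Passing to the circular analog of the input does not decrease the mutual information over a
channel with circular noise. -/
theorem mutualInfo_channelLaw_le_circularAnalog {m n : ℕ} (H : Matrix (Fin n) (Fin m) ℂ)
    (ν : Measure (Fin n → ℂ)) [IsProbabilityMeasure ν] (hν : IsCircular ν)
    (μ : Measure (Fin m → ℂ)) [IsProbabilityMeasure μ] :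
    mutualInfo (channelLaw H ν μ) ≤ mutualInfo (channelLaw H ν (circularAnalog μ)) := by
  have := isProbabilityMeasure_circularAnalog μ
  have hq := isCircular_snd_channelLaw H ν hν (circularAnalog μ) (isCircular_circularAnalog μ)
  rw [channelLaw_eq_compProd H ν (circularAnalog μ)] at hq ⊢
  rw [channelLaw_eq_compProd H ν μ]
  set q := (circularAnalog μ ⊗ₘ channelKernel H ν).snd with hq_def
  calc mutualInfo (μ ⊗ₘ channelKernel H ν)
      ≤ klDiv (μ ⊗ₘ channelKernel H ν) (μ ⊗ₘ Kernel.const _ q) := by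
        have h := mutualInfo_le_klDiv_fst_prod (μ ⊗ₘ channelKernel H ν) q
        rwa [Measure.fst_compProd, ← Measure.compProd_const] at h
    _ ≤ klDiv (circularAnalog μ ⊗ₘ channelKernel H ν)
          (circularAnalog μ ⊗ₘ Kernel.const _ q) := by
        have h := klDiv_comp_right_le (circularAnalog μ ⊗ₘ channelKernel H ν)
          (circularAnalog μ ⊗ₘ Kernel.const _ q) (derotationKernel n μ)
        rwa [derotationKernel_comp_compProd μ _
            fun t ht x => map_phaseRotate_channelKernel H ν hν ht x,
          -- Circularity of `q` is the equivariance of the constant kernel.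
          derotationKernel_comp_compProd μ _ fun t ht x => by
            simpa only [Kernel.const_apply] using hq t ht] at h
    _ = mutualInfo (circularAnalog μ ⊗ₘ channelKernel H ν) := by
        rw [mutualInfo, Measure.fst_compProd, Measure.compProd_const]

theorem mainTheorem5 {m n : ℕ} (H : Matrix (Fin n) (Fin m) ℂ)
    (ν : Measure (Fin n → ℂ)) (hν : IsComplexVectorLaw ν) (hν_circ : IsCircular ν)
    (𝓘 : Set (Measure (Fin m → ℂ))) (h𝓘 : ∀ μ ∈ 𝓘, IsComplexVectorLaw μ)
    (h𝓘_closed : CircularClosed 𝓘) :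
    (∀ μ, IsCapacityAchieving H ν 𝓘 μ →
      IsCircular (circularAnalog μ) ∧ IsCapacityAchieving H ν 𝓘 (circularAnalog μ)) ∧
    ((∃ μ, IsCapacityAchieving H ν 𝓘 μ) →
      ∃ μ, IsCircular μ ∧ IsCapacityAchieving H ν 𝓘 μ) := by
  have key : ∀ μ, IsCapacityAchieving H ν 𝓘 μ →
      IsCircular (circularAnalog μ) ∧ IsCapacityAchieving H ν 𝓘 (circularAnalog μ) := by
    rintro μ ⟨hμ, hcap⟩
    have := hν.1
    have := (h𝓘 μ hμ).1
    refine ⟨isCircular_circularAnalog μ, h𝓘_closed μ hμ, le_antisymm ?_ ?_⟩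
    · exact le_iSup₂ (f := fun μ _ => mutualInfo (channelLaw H ν μ)) _ (h𝓘_closed μ hμ)
    · exact hcap ▸ mutualInfo_channelLaw_le_circularAnalog H ν hν_circ μ
  exact ⟨key, fun ⟨μ, hμ⟩ => ⟨_, key μ hμ⟩⟩
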